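/- Let $p$ be a prime and let $K$ be an algebraically closed field of characteristic $p$, with Frobenius automorphism $\varphi(r)=r^p$. For a finite-dimensional $K$-vector space $V$, let $\operatorname{End}_{\mathbb Z}(V)$ be the monoid, under composition, of additive endomorphisms of $V$. Call $g\in\operatorname{End}_{\mathbb Z}(V)$ *$\varphi$-semilinear* if $g(rv)=\varphi(r)g(v)$ for all $r\in K$, $v\in V$. Let $\Sigma_p=\{0,\dots,p-1\}$, let $\Sigma_p^*$ be the set of finite strings over $\Sigma_p$ (including the empty string), and let $L_p^0\subset\Sigma_p^*$ be the set of strings not beginning with $0$ (so $\emptyset\in L_p^0$). For $s=s_0\cdots s_n\in L_p^0$ put $|s|=\sum_{j=0}^n s_jp^{n-j}$ (and $|\emptyset|=0$); this is a bijection from $L_p^0$ to $\mathbb Z_{\ge 0}$. Let $\operatorname{rev}$ denote reversal of strings. A function $f':\Sigma_p^*\to\operatorname{End}_{\mathbb Z}(V)$ is *$\varphi$-composed* if there are $\varphi$-semilinear endomorphisms $\tau(0),\dots,\tau(p-1)$ of $V$ with $f'(a_1\cdots a_n)=\tau(a_1)\circ\cdots\circ\tau(a_n)$ for all $a_1\cdots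 a_n\in\Sigma_p^*$ (so $f'(\emptyset)=\mathrm{id}_V$). A function $f:\Sigma_p^*\to\operatorname{End}_{\mathbb Z}(V)$ is *potentially $\varphi$-composed* if there exist a finite-dimensional $K$-vector space $V'$, a $K$-linear injection $\iota:V\to V'$, a $K$-linear surjection $\pi:V'\to V$ and a $\varphi$-composed function $f':\Sigma_p^*\to\operatorname{End}_{\mathbb Z}(V')$ such that $f(s)=\pi\circ f'(s)\circ\iota$ for all $s\in\Sigma_p^*$. For $L\subseteq\Sigma_p^*$, a function $f:L\to\operatorname{End}_{\mathbb Z}(V)$ is *$\varphi$-automatic* if its extension by zero to $\Sigma_p^*$ is potentially $\varphi$-composed. A power series $x=\sum_{n\ge0}x_nt^n\in K[[t]]$ is *$p$-automatic* if there is a $\varphi$-automatic function $f:\operatorname{rev}(L_p^0)\to\operatorname{End}_{\mathbb Z}(K)$ (viewing $K$ as a one-dimensional vector space over itself) such that $x_{|s|}=f(\operatorname{rev}(s))(1)$ for all $s\in L_p^0$. **Theorem.** A power series $x\in K[[t]]$, viewed as an element of $K((t))$, is integral over $K(t)$ if and only if it is $p$-automatic. -/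

import Mathlib

open scoped RatFunc

universe u v

namespace ChristolGen

/-- The strings over the alphabet `{0, …, p-1}` that do not begin with `0`. -/
def standardWords (p : ℕ) : Language (Fin p) :=
  {s | ∀ a ∈ s.head?, (a : ℕ) ≠ 0}

/-- The natural number `∑ s_j p^(n-j)` with base-`p` expansion `s = s_0 ⋯ s_n`,
most significant digit first (`Nat.ofDigits` expects the least significant one first). -/
def wordValue {p : ℕ} (s : List (Fin p)) : ℕ :=
  Nat.ofDigits p (s.reverse.map Fin.val)

section Composed

variable {F : Type u} [Field F] (φ : F ≃+* F) {p : ℕ} {V : Type v} [AddCommGroup V] [Module F V]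

/-- An additive endomorphism `g` with `g (r v) = φ(r) g(v)`. -/
def IsSemilinear (g : AddMonoid.End V) : Prop :=
  ∀ (r : F) (v : V), g (r • v) = φ r • g v

/-- `f (a₁ ⋯ aₙ) = τ(a₁) ∘ ⋯ ∘ τ(aₙ)` for some family `τ` of `φ`-semilinear endomorphisms
(multiplication in `AddMonoid.End V` is composition). -/
def IsComposed (f : List (Fin p) → AddMonoid.End V) : Prop :=
  ∃ τ : Fin p → AddMonoid.End V, (∀ a, IsSemilinear φ (τ a)) ∧ ∀ s, f s = (s.map τ).prod

/-- `f(s) = π ∘ f'(s) ∘ ι` for a `φ`-composed `f'` on a finite-dimensional space `V'`,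
a linear injection `ι : V → V'` and a linear surjection `π : V' → V`. -/
def IsPotentiallyComposed (f : List (Fin p) → AddMonoid.End V) : Prop :=
  ∃ (V' : Type u) (_ : AddCommGroup V') (_ : Module F V') (_ : FiniteDimensional F V')
    (ι : V →ₗ[F] V') (π : V' →ₗ[F] V) (f' : List (Fin p) → AddMonoid.End V'),
    Function.Injective ι ∧ Function.Surjective π ∧ IsComposed φ f' ∧
      ∀ s v, f s v = π (f' s (ι v))

open Classical in
/-- Extension by zero of a function on a language `L` to all strings. -/
noncomputable def extendByZero {L : Language (Fin p)} (f : {s // s ∈ L} → AddMonoid.End V) :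
    List (Fin p) → AddMonoid.End V :=
  fun s => if h : s ∈ L then f ⟨s, h⟩ else 0

/-- A function on a language is `φ`-automatic if its extension by zero is potentially
`φ`-composed. -/
def IsAutomatic {L : Language (Fin p)} (f : {s // s ∈ L} → AddMonoid.End V) : Prop :=
  IsPotentiallyComposed φ (extendByZero f)

end Composed

/-- A power series `∑ x_n t^n` over a perfect field of characteristic `p` is `p`-automatic if
`x_{|s|} = f(rev s)(1)` for all strings `s` not beginning with `0`, where `f` is a
Frobenius-automatic function on the language of reversals of such strings. -/
def IsPAutomatic {K : Type u} [Field K] (p : ℕ) [ExpChar K p] [PerfectRing K p]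
    (x : PowerSeries K) : Prop :=
  ∃ f : {s // s ∈ (standardWords p).reverse} → AddMonoid.End K,
    IsAutomatic (frobeniusEquiv K p) f ∧
      ∀ (s : List (Fin p)) (hs : s ∈ standardWords p),
        PowerSeries.coeff (wordValue s) x =
          f ⟨s.reverse, Language.reverse_mem_reverse.mpr hs⟩ 1

end ChristolGen

/-! Write `y = ∑ t^d (Λ_d y)^p`, where `Λ_d` is `digitSection`. A coefficient of `y` is found by
applying the `Λ_d` along the base-`p` digits of its index, taking a constant term and undoing the
`p`-th roots.

If `x` is algebraic, its powers `x^(p^i)` lie in a finite-dimensional `K(t)`-space, so `∑ a_i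
x^(p^i) = 0` for polynomials `a_i`, not all zero; applying sections arranges `a_0 ≠ 0`
(`exists_separable_relation`). The `y` for which `a_0 y` is a combination of the `x^(p^i)` with
coefficients of bounded degree then form a finite-dimensional space containing `x` and stable under
every `Λ_d` (`digitSection_mem_comap`). The transposed sections on its dual give the automaton
(`isPAutomatic_of_stable`).

Conversely, the coordinates of the states of an automaton have generating series satisfying `E = A
E^p + c` with `A` and `c` polynomial. Such a system is étale in characteristic `p`, so its solutions
are algebraic (`isIntegral_of_eq_sum_mul_pow`), and `x` is a `K`-combination of them. -/

namespace ChristolGen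

section Unramified

variable {k L ι : Type*} [Field k] [CommRing L] [Algebra k L]

/-- The Jacobian of the system `E i = ∑ j, A i j * E j ^ p + c i` in characteristic `p` is the
identity, so its solutions generate an unramified, hence finite, algebra. -/
theorem isIntegral_of_eq_sum_mul_pow [Finite ι] (p : ℕ) [CharP L p] (s : Finset ι)
    (E : ι → L) (A : ι → ι → k) (c : ι → k)
    (h : ∀ i, E i = ∑ j ∈ s, algebraMap k L (A i j) * E j ^ p + algebraMap k L (c i)) (i : ι) :
    IsIntegral k (E i) := by
  set S := Algebra.adjoin k (Set.range E)
  let E' : ι → S := fun i => ⟨E i, Algebra.subset_adjoin ⟨i, rfl⟩⟩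
  have hE' : ∀ i, E' i = ∑ j ∈ s, algebraMap k S (A i j) * E' j ^ p + algebraMap k S (c i) := by
    intro i
    apply Subtype.ext
    simpa [E'] using h i
  have hp : (p : S) = 0 := Subtype.ext (by simp)
  have hD : ∀ i, KaehlerDifferential.D k S (E' i) = 0 := by
    intro i
    rw [hE' i, map_add, Derivation.map_algebraMap, add_zero, map_sum]
    refine Finset.sum_eq_zero fun j _ => ?_
    rw [Derivation.leibniz, Derivation.map_algebraMap, smul_zero, add_zero,
      Derivation.leibniz_pow, ← Nat.cast_smul_eq_nsmul S, hp, zero_smul, smul_zero]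
  have htop : Algebra.adjoin k (((↑) : S → L) ⁻¹' Set.range E) = ⊤ :=
    Algebra.adjoin_adjoin_coe_preimage
  have hEq : Set.EqOn (KaehlerDifferential.D k S) (0 : Derivation k S _)
      (((↑) : S → L) ⁻¹' Set.range E) := by
    rintro y ⟨i, hi⟩
    have : y = E' i := Subtype.ext hi.symm
    rw [this, hD]
    rfl
  have hzero : ∀ y, KaehlerDifferential.D k S y = 0 := fun y =>
    Derivation.eqOn_adjoin hEq (by rw [htop]; trivial)
  have hsub : Subsingleton (Ω[S⁄k]) := by
    rw [← Submodule.subsingleton_iff S, ← subsingleton_iff_bot_eq_top,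
      ← KaehlerDifferential.span_range_derivation, eq_comm, Submodule.span_eq_bot]
    rintro _ ⟨y, rfl⟩
    exact hzero y
  have : Algebra.FormallyUnramified k S := ⟨hsub⟩
  have : Algebra.FiniteType k S :=
    S.fg_iff_finiteType.mp (Subalgebra.fg_def.mpr ⟨_, Set.finite_range E, rfl⟩)
  have : Module.Finite k S := Algebra.FormallyUnramified.finite_of_free k S
  exact (Algebra.IsIntegral.isIntegral (R := k) (E' i)).map S.val

end Unramified

/-! ### Splitting a power series by residues of exponents; degree bounds -/

section Sections

open PowerSeries

variable {R : Type*} [CommRing R] {p : ℕ}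

/-- The series `∑ y_(p m + d) t^m`. -/
noncomputable def digitPart (p d : ℕ) : PowerSeries R →ₗ[R] PowerSeries R where
  toFun y := mk fun m => coeff (p * m + d) y
  map_add' _ _ := by ext; simp
  map_smul' _ _ := by ext; simp

@[simp]
theorem coeff_digitPart (d m : ℕ) (y : PowerSeries R) :
    coeff m (digitPart p d y) = coeff (p * m + d) y := by
  simp [digitPart]

theorem coeff_sum_X_pow_mul_expand (hp : p ≠ 0) (g : Fin p → PowerSeries R) (m : ℕ) (d : Fin p) :
    coeff (p * m + d) (∑ i : Fin p, X ^ (i : ℕ) * expand p hp (g i)) = coeff m (g d) := by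
  rw [map_sum, Finset.sum_eq_single d]
  · rw [coeff_X_pow_mul, coeff_expand_mul]
  · intro i _ hi
    rw [coeff_X_pow_mul']
    split_ifs with hle
    · refine coeff_expand_of_not_dvd p hp _ fun hdvd => hi ?_
      have h1 : (p * m + d) % p = i % p :=
        ((Nat.modEq_iff_dvd' hle).mpr hdvd).symm
      rw [Nat.mul_add_mod, Nat.mod_eq_of_lt d.2, Nat.mod_eq_of_lt i.2] at h1
      exact Fin.ext h1.symm
    · rfl
  · simp

theorem sum_X_pow_mul_expand_digitPart (hp : p ≠ 0) (y : PowerSeries R) :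
    ∑ i : Fin p, X ^ (i : ℕ) * expand p hp (digitPart p i y) = y := by
  ext n
  have hlt := Nat.mod_lt n (Nat.pos_of_ne_zero hp)
  have := coeff_sum_X_pow_mul_expand hp (fun i => digitPart p i y) (n / p) ⟨n % p, hlt⟩
  simpa [Nat.div_add_mod] using this

theorem digitPart_expand_mul (hp : p ≠ 0) (u y : PowerSeries R) (d : Fin p) :
    digitPart p d (expand p hp u * y) = u * digitPart p d y := by
  conv_lhs => rw [← sum_X_pow_mul_expand_digitPart hp y]
  ext m
  rw [coeff_digitPart, Finset.mul_sum]
  have : ∀ i : Fin p, expand p hp u * (X ^ (i : ℕ) * expand p hp (digitPart p i y)) =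
      X ^ (i : ℕ) * expand p hp (u * digitPart p i y) := fun i => by
    rw [map_mul]; ring
  simp_rw [this]
  exact coeff_sum_X_pow_mul_expand hp (fun i => u * digitPart p i y) m d

/-- Power series all of whose coefficients of degree greater than `N` vanish. -/
def degreeBounded (R : Type*) [CommRing R] (N : ℕ) : Submodule R (PowerSeries R) where
  carrier := {y | ∀ m, N < m → coeff m y = 0}
  add_mem' ha hb m hm := by rw [map_add, ha m hm, hb m hm, add_zero]
  zero_mem' _ _ := map_zero _
  smul_mem' r y hy m hm := by rw [map_smul, hy m hm, smul_zero]

theorem degreeBounded_mono {M N : ℕ} (h : M ≤ N) : degreeBounded R M ≤ degreeBounded R N :=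
  fun _ hy m hm => hy m (h.trans_lt hm)

theorem mul_mem_degreeBounded {M N : ℕ} {y z : PowerSeries R} (hy : y ∈ degreeBounded R M)
    (hz : z ∈ degreeBounded R N) : y * z ∈ degreeBounded R (M + N) := by
  intro m hm
  rw [coeff_mul]
  refine Finset.sum_eq_zero fun ij hij => ?_
  rw [Finset.HasAntidiagonal.mem_antidiagonal] at hij
  rcases lt_or_ge M ij.1 with h | h
  · rw [hy _ h, zero_mul]
  · rw [hz ij.2 (by omega), mul_zero]

theorem pow_mem_degreeBounded {N : ℕ} {y : PowerSeries R} (hy : y ∈ degreeBounded R N) (k : ℕ) :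
    y ^ k ∈ degreeBounded R (k * N) := by
  induction k with
  | zero =>
    intro m hm
    rw [pow_zero, coeff_one, if_neg (by omega)]
  | succ k ih =>
    rw [pow_succ, Nat.succ_mul]
    exact mul_mem_degreeBounded ih hy

instance (K : Type*) [Field K] (N : ℕ) : FiniteDimensional K (degreeBounded K N) := by
  let f : degreeBounded K N →ₗ[K] Fin (N + 1) → K :=
    LinearMap.pi fun i => (coeff (i : ℕ)).comp (degreeBounded K N).subtype
  refine Module.Finite.of_injective f fun y z h => Subtype.ext ?_
  ext m
  rcases lt_or_ge N m with hm | hm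
  · rw [y.2 m hm, z.2 m hm]
  · exact congrFun h ⟨m, by omega⟩

end Sections

/-! ### Frobenius relations and spaces stable under the sections -/

section Frobenius

open PowerSeries

variable {K : Type u} [Field K] {p : ℕ}

/-- The linear combinations of `x, x^p, …, x^(p^n)` with coefficients of bounded degree. -/
noncomputable def frobeniusSpan (p : ℕ) (x : PowerSeries K) (n N : ℕ) :
    Submodule K (PowerSeries K) :=
  LinearMap.range (∑ i : Fin (n + 1), (LinearMap.mulRight K (x ^ p ^ (i : ℕ))).comp
    ((degreeBounded K N).subtype.comp (LinearMap.proj (φ := fun _ => degreeBounded K N) i)))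

theorem mem_frobeniusSpan_iff (x : PowerSeries K) (n N : ℕ) (y : PowerSeries K) :
    y ∈ frobeniusSpan p x n N ↔ ∃ c : ℕ → PowerSeries K, (∀ i, c i ∈ degreeBounded K N) ∧
      ∑ i ∈ Finset.range (n + 1), c i * x ^ p ^ i = y := by
  constructor
  · rintro ⟨c, rfl⟩
    refine ⟨fun i => if h : i < n + 1 then c ⟨i, h⟩ else 0, fun i => ?_, ?_⟩
    · dsimp only
      split_ifs
      · exact (c _).2
      · exact zero_mem _
    · rw [Finset.sum_range]
      simp [Fin.is_le]
  · rintro ⟨c, hc, rfl⟩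
    refine ⟨fun i => ⟨c i, hc i⟩, ?_⟩
    rw [Finset.sum_range]
    simp

instance (x : PowerSeries K) (n N : ℕ) : FiniteDimensional K (frobeniusSpan p x n N) :=
  Module.Finite.range _

theorem expand_map_frobenius [ExpChar K p] (hp : p ≠ 0) (u : PowerSeries K) :
    expand p hp (map (frobenius K p) u) = u ^ p := by
  rw [← map_expand]
  exact MvPowerSeries.map_frobenius_expand p hp

variable [ExpChar K p] [PerfectRing K p]

variable (K p) in
/-- The series `∑ (y_(p m + d))^(1/p) t^m`. -/
noncomputable def digitSection (d : ℕ) : PowerSeries K →+ PowerSeries K :=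
  (map ((frobeniusEquiv K p).symm : K →+* K)).toAddMonoidHom.comp (digitPart p d).toAddMonoidHom

theorem coeff_digitSection (d m : ℕ) (y : PowerSeries K) :
    coeff m (digitSection K p d y) = (frobeniusEquiv K p).symm (coeff (p * m + d) y) := by
  simp [digitSection]

theorem digitSection_smul (d : ℕ) (r : K) (y : PowerSeries K) :
    digitSection K p d (r • y) = (frobeniusEquiv K p).symm r • digitSection K p d y := by
  ext m
  simp [coeff_digitSection]

/-- `u ^ p` is a series in `t^p` with the coefficients of `u` raised to the `p`-th power; the
section undoes both changes. -/
theorem digitSection_pow_mul (hp : p ≠ 0) (u y : PowerSeries K) (d : Fin p) :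
    digitSection K p d (u ^ p * y) = u * digitSection K p d y := by
  have h : digitSection K p d (u ^ p * y) =
      map ((frobeniusEquiv K p).symm : K →+* K) (digitPart p d (u ^ p * y)) := rfl
  rw [h, ← expand_map_frobenius hp, digitPart_expand_mul, map_mul]
  congr 1
  ext m
  rw [coeff_map, coeff_map]
  exact frobeniusEquiv_symm_apply_frobenius K p _

theorem digitSection_mem_degreeBounded {d M N : ℕ} (h : M < p * (N + 1))
    {y : PowerSeries K} (hy : y ∈ degreeBounded K M) :
    digitSection K p d y ∈ degreeBounded K N := by
  intro m hm
  have : p * (N + 1) ≤ p * m := Nat.mul_le_mul_left _ hm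
  rw [coeff_digitSection, hy _ (by omega), map_zero]

theorem exists_digitSection_ne_zero (hp : p ≠ 0) {y : PowerSeries K} (hy : y ≠ 0) :
    ∃ d : Fin p, digitSection K p d y ≠ 0 := by
  by_contra! h
  apply hy
  ext n
  have h1 := congrArg (coeff (n / p)) (h ⟨n % p, Nat.mod_lt n (Nat.pos_of_ne_zero hp)⟩)
  rw [coeff_digitSection, map_zero, Nat.div_add_mod] at h1
  simpa using h1

/-- A nontrivial `p`-polynomial relation can be replaced by a separable one. -/
theorem exists_separable_relation (hp : p ≠ 0) (x : PowerSeries K) {N : ℕ} (n : ℕ)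
    (a : ℕ → PowerSeries K) (ha : ∀ i, a i ∈ degreeBounded K N) (hne : ∃ i ≤ n, a i ≠ 0)
    (hrel : ∑ i ∈ Finset.range (n + 1), a i * x ^ p ^ i = 0) :
    ∃ (n : ℕ) (a : ℕ → PowerSeries K), (∀ i, a i ∈ degreeBounded K N) ∧ a 0 ≠ 0 ∧
      ∑ i ∈ Finset.range (n + 1), a i * x ^ p ^ i = 0 := by
  induction n generalizing a with
  | zero =>
    obtain ⟨i, hi, h⟩ := hne
    obtain rfl : i = 0 := by omega
    exact ⟨0, a, ha, h, hrel⟩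
  | succ n ih =>
    by_cases h0 : a 0 = 0
    · obtain ⟨i, hi, hai⟩ := hne
      obtain ⟨j, rfl⟩ : ∃ j, i = j + 1 :=
        Nat.exists_eq_succ_of_ne_zero (by rintro rfl; exact hai h0)
      -- With `a 0 = 0` every remaining term contains a `p`-th power, so a section lowers all
      -- Frobenius exponents by one; `d` is chosen to keep one coefficient alive.
      obtain ⟨d, hd⟩ := exists_digitSection_ne_zero hp hai
      refine ih (fun i => digitSection K p d (a (i + 1))) (fun i => ?_) ⟨j, by omega, hd⟩ ?_
      · refine digitSection_mem_degreeBounded ?_ (ha _)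
        have : 1 * (N + 1) ≤ p * (N + 1) := Nat.mul_le_mul_right _ (Nat.pos_of_ne_zero hp)
        omega
      · rw [Finset.sum_range_succ', h0, zero_mul, add_zero] at hrel
        have := congrArg (digitSection K p d) hrel
        rw [map_sum, map_zero] at this
        rw [← this]
        refine Finset.sum_congr rfl fun i _ => ?_
        rw [pow_succ, pow_mul, mul_comm (a _), digitSection_pow_mul hp, mul_comm]
    · exact ⟨n + 1, a, ha, h0, hrel⟩

/-- Since `a_0 Λ_d(y) = Λ_d(a_0^p y)`, it suffices to write `a_0^p y` in terms of `x^p, …, x^(p^n)`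
alone: the relation trades `a_0 x` for higher Frobenius powers. Coefficient degrees grow to at most
`(p - 1) M + N ≤ 2 N`, and the section divides them by `p ≥ 2`. -/
theorem digitSection_mem_comap (hp : 2 ≤ p) {x : PowerSeries K} {n M N : ℕ}
    {a : ℕ → PowerSeries K} (ha : ∀ i, a i ∈ degreeBounded K M)
    (hrel : ∑ i ∈ Finset.range (n + 1), a i * x ^ p ^ i = 0) (hN : (p - 1) * M ≤ N)
    (d : Fin p) {y : PowerSeries K}
    (hy : y ∈ (frobeniusSpan p x n N).comap (LinearMap.mulLeft K (a 0))) :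
    digitSection K p d y ∈ (frobeniusSpan p x n N).comap (LinearMap.mulLeft K (a 0)) := by
  have hp0 : p ≠ 0 := by omega
  obtain ⟨q, hq⟩ := Nat.exists_eq_add_of_le' hp
  rw [Submodule.mem_comap, LinearMap.mulLeft_apply, mem_frobeniusSpan_iff] at hy ⊢
  obtain ⟨c, hc, hcy⟩ := hy
  -- Here `p = q + 2`, and `b i` is the coefficient of `x^(p^(i+1))` in `a_0^p y` once the linear
  -- term has been eliminated.
  let b : ℕ → PowerSeries K := fun i => a 0 ^ (q + 1) * c (i + 1) - a 0 ^ q * a (i + 1) * c 0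
  have hb : ∀ i, b i ∈ degreeBounded K ((q + 1) * M + N) := fun i => by
    refine sub_mem (mul_mem_degreeBounded (pow_mem_degreeBounded (ha 0) _) (hc _)) ?_
    refine mul_mem_degreeBounded ?_ (hc _)
    rw [Nat.succ_mul]
    exact mul_mem_degreeBounded (pow_mem_degreeBounded (ha 0) _) (ha _)
  refine ⟨fun i => if i < n then digitSection K p d (b i) else 0, fun i => ?_, ?_⟩
  · dsimp only
    split_ifs
    · refine digitSection_mem_degreeBounded ?_ (hb i)
      have h1 : (q + 1) * M ≤ N := by simpa [hq] using hN
      have h2 : 2 * (N + 1) ≤ p * (N + 1) := Nat.mul_le_mul_right _ hp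
      omega
    · exact zero_mem _
  · have key : a 0 ^ p * y = ∑ i ∈ Finset.range n, (x ^ p ^ i) ^ p * b i := by
      rw [Finset.sum_range_succ'] at hrel hcy
      have h1 : a 0 ^ p * y = a 0 ^ (q + 1) *
          (∑ i ∈ Finset.range n, c (i + 1) * x ^ p ^ (i + 1) + c 0 * x ^ p ^ 0) -
          a 0 ^ q * c 0 *
          (∑ i ∈ Finset.range n, a (i + 1) * x ^ p ^ (i + 1) + a 0 * x ^ p ^ 0) := by
        rw [hrel, hcy, hq]; ring
      have h2 : ∑ i ∈ Finset.range n, (x ^ p ^ i) ^ p * b i =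
          a 0 ^ (q + 1) * ∑ i ∈ Finset.range n, c (i + 1) * x ^ p ^ (i + 1) -
          a 0 ^ q * c 0 * ∑ i ∈ Finset.range n, a (i + 1) * x ^ p ^ (i + 1) := by
        rw [Finset.mul_sum, Finset.mul_sum, ← Finset.sum_sub_distrib]
        refine Finset.sum_congr rfl fun i _ => ?_
        rw [← pow_mul, ← pow_succ]
        ring
      rw [h1, h2]
      ring
    have key2 := congrArg (digitSection K p d) key
    rw [digitSection_pow_mul hp0, map_sum] at key2
    rw [key2, Finset.sum_range_succ]
    dsimp only
    rw [if_neg (lt_irrefl n), zero_mul, add_zero]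
    refine Finset.sum_congr rfl fun i hi => ?_
    rw [if_pos (Finset.mem_range.mp hi), digitSection_pow_mul hp0, mul_comm]

/-- A separable `p`-polynomial relation produces a finite-dimensional space of power series which
is stable under the digit sections. -/
theorem exists_finiteDimensional_stable (hp : 2 ≤ p) {x : PowerSeries K} {n M : ℕ}
    {a : ℕ → PowerSeries K} (ha : ∀ i, a i ∈ degreeBounded K M) (h0 : a 0 ≠ 0)
    (hrel : ∑ i ∈ Finset.range (n + 1), a i * x ^ p ^ i = 0) :
    ∃ W : Submodule K (PowerSeries K), FiniteDimensional K W ∧ x ∈ W ∧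
      ∀ (d : Fin p), ∀ y ∈ W, digitSection K p d y ∈ W := by
  refine ⟨(frobeniusSpan p x n ((p - 1) * M)).comap (LinearMap.mulLeft K (a 0)), ?_, ?_,
    fun d y hy => digitSection_mem_comap hp ha hrel le_rfl d hy⟩
  · let f := (LinearMap.mulLeft K (a 0)).restrict
      (p := (frobeniusSpan p x n ((p - 1) * M)).comap (LinearMap.mulLeft K (a 0)))
      (q := frobeniusSpan p x n ((p - 1) * M)) fun y hy => hy
    refine Module.Finite.of_injective f fun y z h => Subtype.ext ?_
    exact mul_left_cancel₀ h0 (congrArg Subtype.val h)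
  · rw [Submodule.mem_comap, LinearMap.mulLeft_apply, mem_frobeniusSpan_iff]
    refine ⟨fun i => if i = 0 then a 0 else 0, fun i => ?_, ?_⟩
    · dsimp only
      split_ifs
      · refine degreeBounded_mono ?_ (ha 0)
        exact Nat.le_mul_of_pos_left _ (by omega)
      · exact zero_mem _
    · rw [Finset.sum_range_succ']
      simp

end Frobenius


theorem addMonoidEnd_mul_apply {M : Type*} [AddCommMonoid M] (f g : AddMonoid.End M) (y : M) :
    (f * g) y = f (g y) :=
  rfl

/-! ### From algebraic to automatic -/

section AutomaticOfIntegral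

open PowerSeries

variable {K : Type u} [Field K] {p : ℕ} [ExpChar K p] [PerfectRing K p]

/-- A series whose coefficients are read off by a composed function is automatic: add a start
state that cannot be reached from the digit `0`. -/
theorem isPAutomatic_of_forall_coeff {D : Type u} [AddCommGroup D] [Module K D]
    [FiniteDimensional K D] {x : PowerSeries K} (τ : Fin p → AddMonoid.End D)
    (hτ : ∀ d, IsSemilinear (frobeniusEquiv K p) (τ d)) (v : D) (π : D →ₗ[K] K)
    (h : ∀ w : List (Fin p), coeff (Nat.ofDigits p (w.map Fin.val)) x = π ((w.map τ).prod v)) :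
    IsPAutomatic p x := by
  let φ := frobeniusEquiv K p
  -- The middle coordinate is the start state. The last letter of a word acts first and is the
  -- leading digit, so sending the start state to zero on digit `0` kills the words outside the
  -- language. The last coordinate, killed by every letter, only makes `π'` surjective.
  let σ : Fin p → AddMonoid.End (D × K × K) := fun d =>
    { toFun := fun y => (τ d y.1 + (if (d : ℕ) = 0 then 0 else φ y.2.1 • τ d v), 0, 0)
      map_zero' := by simp
      map_add' := fun y z => by
        split_ifs
        · simp
        · simp [add_smul]; abel }
  have hσ : ∀ d y, σ d y = (τ d y.1 + (if (d : ℕ) = 0 then 0 else φ y.2.1 • τ d v), 0, 0) :=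
    fun _ _ => rfl
  have hσs : ∀ d, IsSemilinear (frobeniusEquiv K p) (σ d) := fun d r y => by
    rw [hσ, hσ]
    split_ifs
    · simp [hτ d r]
    · simp [hτ d r, mul_smul, φ]
  have hprod : ∀ (w : List (Fin p)) (g : D),
      (w.map σ).prod (g, 0, 0) = ((w.map τ).prod g, 0, 0) := by
    intro w g
    induction w with
    | nil => rfl
    | cons d w ih =>
      rw [List.map_cons, List.map_cons, List.prod_cons, List.prod_cons, addMonoidEnd_mul_apply,
        addMonoidEnd_mul_apply, ih, hσ]
      simp
  let ι : K →ₗ[K] D × K × K := LinearMap.inr K D (K × K) ∘ₗ LinearMap.inl K K K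
  let π' : D × K × K →ₗ[K] K :=
    π.coprod (LinearMap.coprod (LinearMap.toSpanSingleton K K (π v)) LinearMap.id)
  have hπ' : ∀ y, π' y = π y.1 + (y.2.1 * π v + y.2.2) := fun y => by simp [π']
  have hconcat : ∀ (w : List (Fin p)) (d : Fin p) (r : K),
      π' (((w ++ [d]).map σ).prod (ι r)) =
        if (d : ℕ) = 0 then 0 else π ((w.map τ).prod (φ r • τ d v)) := by
    intro w d r
    have : σ d (ι r) = (if (d : ℕ) = 0 then 0 else φ r • τ d v, 0, 0) := by
      rw [hσ]; simp [ι]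
    rw [List.map_append, List.prod_append, List.map_singleton, List.prod_singleton,
      addMonoidEnd_mul_apply, this, hprod, hπ']
    split_ifs <;> simp
  let f : List (Fin p) → AddMonoid.End K := fun s =>
    π'.toAddMonoidHom.comp (((s.map σ).prod : (D × K × K) →+ (D × K × K)).comp ι.toAddMonoidHom)
  have hf : ∀ s r, f s r = π' ((s.map σ).prod (ι r)) := fun _ _ => rfl
  refine ⟨fun s => f s, ⟨D × K × K, inferInstance, inferInstance, inferInstance, ι, π',
    fun s => (s.map σ).prod, ?_, ?_, ⟨σ, hσs, fun _ => rfl⟩, ?_⟩, ?_⟩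
  · intro r s hrs
    exact congrArg (fun y : D × K × K => y.2.1) hrs
  · intro r
    exact ⟨(0, 0, r), by simp [hπ']⟩
  · intro s r
    unfold extendByZero
    split_ifs with hs
    · exact hf s r
    · rcases List.eq_nil_or_concat s with rfl | ⟨w, d, rfl⟩
      · exact absurd (by intro a ha; simp at ha) hs
      · dsimp only
        rw [List.concat_eq_append, hconcat, if_pos]
        · rfl
        · by_contra hd
          refine hs ?_
          intro a ha
          obtain rfl : d = a := by simpa using ha
          exact hd
  · intro s hs
    rw [hf, wordValue, h]
    dsimp only
    rcases List.eq_nil_or_concat s.reverse with hnil | ⟨w, d, hw⟩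
    · rw [hnil]
      simp [hπ', ι]
    · have hd : (d : ℕ) ≠ 0 := by
        refine hs d ?_
        rw [← List.reverse_reverse s, hw]
        simp
      rw [hw, List.concat_eq_append, hconcat, if_neg hd, map_one, one_smul,
        List.map_append, List.prod_append, addMonoidEnd_mul_apply]
      simp

/-- The coefficients of a member of a stable space are computed on its dual by the transposes of
the digit sections. -/
theorem isPAutomatic_of_stable {x : PowerSeries K} (W : Submodule K (PowerSeries K))
    [FiniteDimensional K W] (hx : x ∈ W)
    (hW : ∀ d : Fin p, ∀ y ∈ W, digitSection K p d y ∈ W) : IsPAutomatic p x := by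
  let φ := frobeniusEquiv K p
  -- Sections are `φ⁻¹`-semilinear; composing with `φ` keeps the functional linear and makes the
  -- transpose `φ`-semilinear in `l`. Transposing also reverses the order of composition, as needed
  -- for words with the least significant digit first.
  let τ : Fin p → AddMonoid.End (Module.Dual K W) := fun d =>
    { toFun := fun l =>
        { toFun := fun y => φ (l ⟨digitSection K p d y, hW d y y.2⟩)
          map_add' := fun y z => by
            rw [← map_add, ← map_add]
            congr 2
            exact Subtype.ext (map_add (digitSection K p d) (y : PowerSeries K) z)
          map_smul' := fun r y => by
            have : (⟨digitSection K p d (r • y : W), hW d _ (r • y).2⟩ : W) =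
                φ.symm r • ⟨digitSection K p d y, hW d y y.2⟩ :=
              Subtype.ext (digitSection_smul _ _ _)
            rw [this, map_smul, smul_eq_mul, map_mul, RingEquiv.apply_symm_apply]
            rfl }
      map_zero' := by ext; simp
      map_add' := fun l l' => by ext; simp }
  have hτ : ∀ d l y, τ d l y = φ (l ⟨digitSection K p d y, hW d y y.2⟩) := fun _ _ _ => rfl
  let ev : Module.Dual K W := (coeff 0).comp W.subtype
  have key : ∀ (w : List (Fin p)) (y : W),
      coeff (Nat.ofDigits p (w.map Fin.val)) (y : PowerSeries K) = (w.map τ).prod ev y := by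
    intro w
    induction w with
    | nil => intro y; rfl
    | cons d w ih =>
      intro y
      rw [List.map_cons, List.map_cons, List.prod_cons, addMonoidEnd_mul_apply, hτ, ← ih,
        coeff_digitSection, Nat.ofDigits_cons, add_comm]
      exact (RingEquiv.apply_symm_apply φ _).symm
  refine isPAutomatic_of_forall_coeff τ (fun d r l => ?_) ev
    (Module.Dual.eval K W ⟨x, hx⟩) fun w => key w ⟨x, hx⟩
  ext y
  rw [hτ, LinearMap.smul_apply, smul_eq_mul, map_mul]
  rfl

/-- An algebraic power series satisfies a nontrivial `p`-polynomial relation with polynomial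
coefficients. -/
theorem exists_relation_of_isIntegral (p : ℕ) {x : PowerSeries K}
    (hx : IsIntegral (RatFunc K) (x : LaurentSeries K)) :
    ∃ (N n : ℕ) (a : ℕ → PowerSeries K), (∀ i, a i ∈ degreeBounded K N) ∧ (∃ i ≤ n, a i ≠ 0) ∧
      ∑ i ∈ Finset.range (n + 1), a i * x ^ p ^ i = 0 := by
  let S := Algebra.adjoin (RatFunc K) {(x : LaurentSeries K)}
  have hfin : Module.Finite (RatFunc K) S :=
    Module.Finite.iff_fg.mpr hx.fg_adjoin_singleton
  let z : S := ⟨x, Algebra.self_mem_adjoin_singleton _ _⟩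
  have hdep : ¬ LinearIndependent (Polynomial K) fun i : ℕ => (x : LaurentSeries K) ^ p ^ i := by
    -- This clears denominators: dependence over `K(t)` already gives polynomial coefficients.
    rw [LinearIndependent.iff_fractionRing (Polynomial K) (RatFunc K)]
    intro hli
    have hli' : LinearIndependent (RatFunc K) fun i : ℕ => z ^ p ^ i :=
      LinearIndependent.of_comp S.val.toLinearMap hli
    exact Infinite.not_finite (α := ℕ) hli'.finite
  rw [linearIndependent_iff'] at hdep
  push Not at hdep
  obtain ⟨s, g, hsum, i, his, hgi⟩ := hdep
  refine ⟨s.sup fun j => (g j).natDegree, s.sup id,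
    fun j => if j ∈ s then (g j : PowerSeries K) else 0, fun j => ?_,
    ⟨i, Finset.le_sup (f := id) his, ?_⟩, ?_⟩
  · dsimp only
    split_ifs with hj
    · intro m hm
      rw [Polynomial.coeff_coe]
      exact Polynomial.coeff_eq_zero_of_natDegree_lt
        ((Finset.le_sup (f := fun j => (g j).natDegree) hj).trans_lt hm)
    · exact zero_mem _
  · simpa [his] using hgi
  · apply HahnSeries.ofPowerSeries_injective (Γ := ℤ)
    rw [map_zero, map_sum, ← hsum]
    symm
    refine Finset.sum_subset_zero_on_sdiff (fun j hj => ?_) (fun j hj => ?_) (fun j hj => ?_)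
    · rw [Finset.mem_range]
      exact Nat.lt_succ_of_le (Finset.le_sup (f := id) hj)
    · simp [(Finset.mem_sdiff.mp hj).2]
    · dsimp only
      rw [if_pos hj, map_mul, map_pow, Algebra.smul_def]
      rfl

end AutomaticOfIntegral

/-! ### From automatic to algebraic -/

section IntegralOfAutomatic

open PowerSeries

variable {K : Type u} [Field K] {p : ℕ}

/-- The state reached on reading the base-`p` digits of `m`. -/
noncomputable def digitState {V : Type*} [AddCommGroup V] (τ : Fin p → AddMonoid.End V) (v : V)
    (m : ℕ) : V :=
  ((p.digits m).map fun d => if h : d < p then τ ⟨d, h⟩ else 0).prod v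

/-- Index `0` is excluded because its expansion is empty: its state is `v`, not `τ 0 v`. -/
theorem digitState_mul_add {V : Type*} [AddCommGroup V] (τ : Fin p → AddMonoid.End V) (v : V)
    (hp : 1 < p) (m : ℕ) (d : Fin p) (h : p * m + d ≠ 0) :
    digitState τ v (p * m + d) = τ d (digitState τ v m) := by
  have hne : (d : ℕ) ≠ 0 ∨ m ≠ 0 := by
    by_contra! h'
    simp [h'.1, h'.2] at h
  rw [digitState, digitState, add_comm, Nat.digits_add p hp d m d.2 hne, List.map_cons,
    List.prod_cons, addMonoidEnd_mul_apply, dif_pos d.2]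

theorem digitState_zero {V : Type*} [AddCommGroup V] (τ : Fin p → AddMonoid.End V) (v : V) :
    digitState τ v 0 = v := by
  simp [digitState]

variable [Fact p.Prime] [CharP K p] [PerfectRing K p]

/-- A `φ`-semilinear map raises coordinates to the `p`-th power before applying a matrix, so the
recursion on states becomes a system `E = A E^p + c` for the coordinate series. -/
theorem isIntegral_mk_repr_digitState {V : Type*} [AddCommGroup V] [Module K V]
    {ι : Type*} [Fintype ι] (b : Module.Basis ι K V) (τ : Fin p → AddMonoid.End V)
    (hτ : ∀ d, IsSemilinear (frobeniusEquiv K p) (τ d)) (v : V) (i : ι) :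
    IsIntegral (RatFunc K)
      ((mk fun m => b.repr (digitState τ v m) i : PowerSeries K) : LaurentSeries K) := by
  have hp : p.Prime := Fact.out
  let E : ι → PowerSeries K := fun i => mk fun m => b.repr (digitState τ v m) i
  let A : ι → ι → Polynomial K := fun i j =>
    ∑ d : Fin p, Polynomial.X ^ (d : ℕ) * Polynomial.C (b.repr (τ d (b j)) i)
  -- Corrects the recursion at index `0`, where it would predict `τ 0 v`.
  let c : ι → K := fun i => b.repr (v - τ ⟨0, hp.pos⟩ v) i
  have hrepr : ∀ (d : Fin p) (w : V) (i : ι),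
      b.repr (τ d w) i = ∑ j, b.repr (τ d (b j)) i * b.repr w j ^ p := by
    intro d w i
    conv_lhs => rw [← b.sum_repr w]
    rw [map_sum, map_sum, Finsupp.finsetSum_apply]
    refine Finset.sum_congr rfl fun j _ => ?_
    rw [hτ d, map_smul, Finsupp.smul_apply, smul_eq_mul, mul_comm]
    rfl
  have hsys : ∀ i, E i = ∑ j, (A i j : PowerSeries K) * E j ^ p + C (c i) := by
    intro i
    have h1 : ∑ j, (A i j : PowerSeries K) * E j ^ p = ∑ d : Fin p, X ^ (d : ℕ) *
        expand p hp.ne_zero (∑ j, C (b.repr (τ d (b j)) i) * map (frobenius K p) (E j)) := by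
      simp_rw [map_sum, map_mul, expand_C, expand_map_frobenius, Finset.mul_sum]
      rw [Finset.sum_comm]
      refine Finset.sum_congr rfl fun j _ => ?_
      have : (A i j : PowerSeries K) =
          ∑ d : Fin p, X ^ (d : ℕ) * C (b.repr (τ d (b j)) i) := by
        change Polynomial.coeToPowerSeries.ringHom (A i j) = _
        simp only [A, map_sum, map_mul, map_pow]
        simp
      rw [this, Finset.sum_mul]
      exact Finset.sum_congr rfl fun d _ => mul_assoc _ _ _
    ext n
    have hlt : n % p < p := Nat.mod_lt n hp.pos
    obtain ⟨m, d, rfl⟩ : ∃ (m : ℕ) (d : Fin p), n = p * m + d :=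
      ⟨n / p, ⟨n % p, hlt⟩, (Nat.div_add_mod n p).symm⟩
    rw [h1, map_add, coeff_sum_X_pow_mul_expand, map_sum]
    have h2 : ∑ j, coeff m (C (b.repr (τ d (b j)) i) * map (frobenius K p) (E j)) =
        b.repr (τ d (digitState τ v m)) i := by
      rw [hrepr]
      refine Finset.sum_congr rfl fun j _ => ?_
      rw [coeff_C_mul, coeff_map, coeff_mk, frobenius_def]
    rw [h2, coeff_mk, coeff_C]
    split_ifs with h0
    · obtain ⟨hm, hd⟩ : m = 0 ∧ d = ⟨0, hp.pos⟩ := by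
        have := Nat.add_eq_zero_iff.mp h0
        exact ⟨by simpa [hp.ne_zero] using this.1, Fin.ext this.2⟩
      rw [h0, hm, hd, digitState_zero]
      simp [c]
    · rw [digitState_mul_add τ v hp.one_lt m d h0, add_zero]
  have hchar : CharP (LaurentSeries K) p :=
    charP_of_injective_algebraMap (algebraMap (RatFunc K) (LaurentSeries K)).injective p
  refine isIntegral_of_eq_sum_mul_pow (k := RatFunc K) p Finset.univ
    (fun i => (E i : LaurentSeries K)) (fun i j => algebraMap (Polynomial K) (RatFunc K) (A i j))
    (fun i => algebraMap (Polynomial K) (RatFunc K) (Polynomial.C (c i))) (fun i => ?_) i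
  simp_rw [← IsScalarTower.algebraMap_apply]
  have := congrArg (HahnSeries.ofPowerSeries ℤ K) (hsys i)
  rw [map_add, map_sum] at this
  refine this.trans ?_
  congr 1
  · refine Finset.sum_congr rfl fun j _ => ?_
    rw [map_mul, map_pow]
    rfl
  · rw [Polynomial.algebraMap_hahnSeries_apply, Polynomial.coe_C]

theorem isIntegral_of_isPAutomatic {x : PowerSeries K} (h : IsPAutomatic p x) :
    IsIntegral (RatFunc K) (x : LaurentSeries K) := by
  have hp : p.Prime := Fact.out
  obtain ⟨f, ⟨V, _, _, _, ι, π, f', -, -, ⟨τ, hτ, hf'⟩, hf⟩, hx⟩ := h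
  have hcoeff : ∀ m, coeff m x = π (digitState τ (ι 1) m) := by
    intro m
    have hlt : ∀ d ∈ p.digits m, d < p := fun d hd => Nat.digits_lt_base hp.one_lt hd
    let w : List (Fin p) := (p.digits m).pmap (fun d h => ⟨d, h⟩) hlt
    have hwval : w.map Fin.val = p.digits m := by simp [w, List.map_pmap]
    have hwτ : w.map τ = (p.digits m).map fun d => if h : d < p then τ ⟨d, h⟩ else 0 := by
      rw [← hwval, List.map_map]
      refine List.map_congr_left fun d _ => ?_
      simp
    -- The leading digit of a nonzero number is nonzero, and `0` gives the empty word.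
    have hs : w.reverse ∈ standardWords p := by
      intro a ha
      rw [List.head?_reverse] at ha
      have h1 : (p.digits m).getLast? = some (a : ℕ) := by
        rw [← hwval, List.getLast?_map, ha]
        rfl
      have hne : p.digits m ≠ [] := by
        rintro h0
        simp [h0] at h1
      rw [List.getLast?_eq_some_getLast hne, Option.some_inj] at h1
      rw [← h1]
      refine Nat.getLast_digit_ne_zero p ?_
      rintro rfl
      exact hne (Nat.digits_zero p)
    have h1 := hx _ hs
    have h2 := hf w.reverse.reverse 1
    rw [extendByZero, dif_pos (Language.reverse_mem_reverse.mpr hs), ← h1, hf', wordValue,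
      List.reverse_reverse, hwval, Nat.ofDigits_digits, hwτ] at h2
    exact h2
  let b := Module.finBasis K V
  have hxsum : x = ∑ i, (Polynomial.C (π (b i)) : PowerSeries K) *
      (mk fun m => b.repr (digitState τ (ι 1) m) i) := by
    ext m
    rw [hcoeff, map_sum]
    conv_lhs => rw [← b.sum_repr (digitState τ (ι 1) m)]
    rw [map_sum]
    refine Finset.sum_congr rfl fun i _ => ?_
    rw [Polynomial.coe_C, coeff_C_mul, coeff_mk, map_smul, smul_eq_mul, mul_comm]
  rw [hxsum, map_sum]
  refine IsIntegral.sum _ fun i _ => ?_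
  rw [map_mul]
  refine IsIntegral.mul ?_ (isIntegral_mk_repr_digitState b τ hτ _ i)
  rw [← Polynomial.algebraMap_hahnSeries_apply,
    IsScalarTower.algebraMap_apply (Polynomial K) (RatFunc K) (LaurentSeries K)]
  exact isIntegral_algebraMap

end IntegralOfAutomatic

end ChristolGen

theorem mainTheorem3 {K : Type u} [Field K] [IsAlgClosed K] (p : ℕ) [Fact p.Prime] [CharP K p]
    (x : PowerSeries K) :
    IsIntegral (RatFunc K) (x : LaurentSeries K) ↔
      ChristolGen.IsPAutomatic p x := by
  have hp : p.Prime := Fact.out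
  refine ⟨fun hx => ?_, ChristolGen.isIntegral_of_isPAutomatic⟩
  obtain ⟨N, n, a, ha, hne, hrel⟩ := ChristolGen.exists_relation_of_isIntegral p hx
  obtain ⟨n, a, ha, h0, hrel⟩ :=
    ChristolGen.exists_separable_relation hp.ne_zero x n a ha hne hrel
  obtain ⟨W, _, hxW, hW⟩ := ChristolGen.exists_finiteDimensional_stable hp.two_le ha h0 hrel
  exact ChristolGen.isPAutomatic_of_stable W hxW hW
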